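/- Let $C$ be a commutative $\mathbb{Q}$-algebra with identity that is an integral domain, such that for every maximal ideal $M$ of $C$ the localization $C_M$ is a unique factorization domain. Let $X$ be a set, let $\lambda\in C$, and put $A=C[X]$, the polynomial algebra on $X$ over $C$ (all tensor products are over $C$). Let $Ш_{C,\lambda}(X)=\bigoplus_{n\ge 0}A^{\otimes(n+1)}$ be the free Baxter $C$-algebra of weight $\lambda$ on $X$, whose multiplication is the mixed shuffle product $$(x_0\otimes x_1\otimes\cdots\otimes x_m)\,(y_0\otimes y_1\otimes\cdots\otimes y_n)=\sum_{s}\lambda^{t(s)}\,x_0y_0\otimes s ,$$ where $s$ runs over all mixable shuffles of $x_1\otimes\cdots\otimes x_m$ and $y_1\otimes\cdots\otimes y_n$, that is, all shuffles of the two words in which any number $t(s)\ge 0$ of adjacent pairs $x_i\otimes y_j$ (a factor $x_i$ immediately followed by a factor $y_j$) have been replaced by their products $x_iy_j$, and whose Baxter operator is $P(x_0\otimes\cdots\otimes x_n)=1\otimes x_0\otimes\cdots\otimes x_n$. Let $\mathrm{Fil}^k=\bigoplus_{n\ge k}A^{\otimes(n+1)}$, an ideal, and let $$\widehat{Ш}_{C,\lambda}(X)=\varprojlim_k\,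 Ш_{C,\lambda}(X)/\mathrm{Fil}^k$$ be the complete free Baxter algebra of weight $\lambda$ on $X$. Then $\widehat{Ш}_{C,\lambda}(X)$ is an integral domain if and only if $\lambda$ is not a unit of $C$. -/

import Mathlib

open scoped TensorProduct DirectSum

noncomputable section

namespace Baxter

/-- For a map `f : Fin m → Fin l`, the algebra homomorphism `A^{⊗m} → A^{⊗l}` (tensor power
algebras over `C`) putting the `i`-th factor into slot `f i`: it sends `x₁ ⊗ ⋯ ⊗ xₘ` to the pure
tensor whose `j`-th factor is the product of the `xᵢ` with `f i = j` (and `1` if there is none). -/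
def place (C : Type*) [CommRing C] (A : Type*) [CommRing A] [Algebra C A] {m l : ℕ}
    (f : Fin m → Fin l) : (⨂[C]^m A) →ₐ[C] (⨂[C]^l A) :=
  PiTensorProduct.liftAlgHom
    ((MultilinearMap.mkPiAlgebra C (Fin m) (⨂[C]^l A)).compLinearMap
      (fun i => (PiTensorProduct.singleAlgHom (R := C) (A := fun _ : Fin l => A)
        (f i)).toLinearMap))
    (by simp [map_one])
    (by intro x y; simp [← Finset.prod_mul_distrib, Pi.mulSingle_mul])

theorem place_tprod (C : Type*) [CommRing C] (A : Type*) [CommRing A] [Algebra C A] {m l : ℕ}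
    (f : Fin m → Fin l) (x : Fin m → A) :
    place C A f (PiTensorProduct.tprod C x) =
      PiTensorProduct.tprod C (fun j => ∏ i with f i = j, x i) := by
  have h : place C A f (PiTensorProduct.tprod C x) =
      ∏ i, PiTensorProduct.tprod C (Pi.mulSingle (f i) (x i) : Fin l → A) := by
    simp [place]
  rw [h, ← PiTensorProduct.tprod_prod]
  congr 1
  ext j
  simp [Finset.prod_apply, Pi.mulSingle_apply, Finset.prod_filter, eq_comm]

theorem place_place (C : Type*) [CommRing C] (A : Type*) [CommRing A] [Algebra C A] {m l k : ℕ}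
    (g : Fin l → Fin k) (f : Fin m → Fin l) (x : ⨂[C]^m A) :
    place C A g (place C A f x) = place C A (g ∘ f) x := by
  suffices h : (place C A g).comp (place C A f) = place C A (g ∘ f) from
    DFunLike.congr_fun h x
  apply AlgHom.toLinearMap_injective
  apply PiTensorProduct.ext
  ext x
  simp only [LinearMap.compMultilinearMap_apply, AlgHom.toLinearMap_apply, AlgHom.comp_apply,
    place_tprod]
  congr 1
  ext j
  simp only [Function.comp]
  rw [Finset.prod_filter]
  simp_rw [Finset.prod_filter]
  rw [← Finset.prod_filter, Finset.prod_comm]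
  refine Finset.prod_congr rfl fun i _ => ?_
  rw [Finset.prod_filter]
  simp_rw [← ite_and]
  by_cases h : g (f i) = j
  · rw [Finset.prod_eq_single (f i)] <;> simp +contextual [h]
    intro b h2 _ h1; exact absurd h1.symm h2
  · rw [if_neg h]
    refine Finset.prod_eq_one fun b _ => if_neg ?_
    rintro ⟨h1, rfl⟩; exact h h1

theorem place_id (C : Type*) [CommRing C] (A : Type*) [CommRing A] [Algebra C A] {m : ℕ}
    (x : ⨂[C]^m A) : place C A (fun i : Fin m => i) x = x := by
  suffices h : place C A (fun i : Fin m => i) = AlgHom.id C _ from DFunLike.congr_fun h x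
  apply AlgHom.toLinearMap_injective
  apply PiTensorProduct.ext
  ext x
  simp [place_tprod, Finset.prod_filter]

open scoped Classical in
/-- The mixable shuffles of a word `x₁ … xₘ` with a word `y₁ … yₙ` having `l` letters, both words
being preceded by a letter (of index `0`) that stays in front. A mixable shuffle is encoded by the
positions `f i` of the `xᵢ` and `g i` of the `yᵢ` in the result: the order of the `xᵢ` and that of
the `yᵢ` are kept, every position is used, and a position used by both words is one where
an adjacent pair `xᵢ, yⱼ` of a shuffle has been merged to the product `xᵢ yⱼ`; the number of
merged pairs is `m + n - l`. -/
def mixableShuffles (m n l : ℕ) :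
    Finset ((Fin (m + 1) → Fin (l + 1)) × (Fin (n + 1) → Fin (l + 1))) :=
  {p | (StrictMono p.1 ∧ p.1 0 = 0) ∧ (StrictMono p.2 ∧ p.2 0 = 0) ∧
    ∀ j, (∃ i, p.1 i = j) ∨ ∃ i, p.2 i = j}

theorem mem_mixableShuffles {m n l : ℕ}
    {p : (Fin (m + 1) → Fin (l + 1)) × (Fin (n + 1) → Fin (l + 1))} :
    p ∈ mixableShuffles m n l ↔ (StrictMono p.1 ∧ p.1 0 = 0) ∧ (StrictMono p.2 ∧ p.2 0 = 0) ∧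
      ∀ j, (∃ i, p.1 i = j) ∨ ∃ i, p.2 i = j := by
  simp [mixableShuffles]

theorem le_of_mem_mixableShuffles {m n l : ℕ}
    {p : (Fin (m + 1) → Fin (l + 1)) × (Fin (n + 1) → Fin (l + 1))}
    (h : p ∈ mixableShuffles m n l) : m ≤ l ∧ n ≤ l ∧ l ≤ m + n := by
  obtain ⟨⟨hf, hf0⟩, ⟨hg, hg0⟩, hc⟩ := mem_mixableShuffles.1 h
  refine ⟨?_, ?_, ?_⟩
  · simpa using Fintype.card_le_of_injective _ hf.injective
  · simpa using Fintype.card_le_of_injective _ hg.injective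
  · have hs : Function.Surjective (Sum.elim p.1 (fun i : Fin n => p.2 i.succ)) := by
      intro j
      rcases hc j with ⟨i, hi⟩ | ⟨i, hi⟩
      · exact ⟨Sum.inl i, hi⟩
      · induction i using Fin.cases with
        | zero => exact ⟨Sum.inl 0, by simp [hf0, ← hi, hg0]⟩
        | succ i => exact ⟨Sum.inr i, hi⟩
    have := Fintype.card_le_of_surjective _ hs
    simp at this
    omega

/-- The component in `A^{⊗(l+1)}` of the mixed shuffle product of weight `lam` on
`A^{⊗(m+1)} × A^{⊗(n+1)}`. For pure tensors `x₀ ⊗ ⋯ ⊗ xₘ` and `y₀ ⊗ ⋯ ⊗ yₙ`, the summand of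
`(f, g)` is `lam ^ (number of merged pairs)` times the tensor `x₀ y₀ ⊗ (mixable shuffle)`: here `*`
is the factorwise product of the tensor power algebra `A^{⊗(l+1)}`, and one of the two factors in
each slot is `1` unless the slot is a merged one or the slot `0`. -/
def shuffleComponent (C : Type*) [CommRing C] (lam : C) (A : Type*) [CommRing A] [Algebra C A]
    (m n l : ℕ) : (⨂[C]^(m + 1) A) →ₗ[C] (⨂[C]^(n + 1) A) →ₗ[C] (⨂[C]^(l + 1) A) :=
  ∑ p ∈ mixableShuffles m n l, lam ^ (m + n - l) •
    (LinearMap.mul C (⨂[C]^(l + 1) A)).compl₁₂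
      (place C A p.1).toLinearMap (place C A p.2).toLinearMap

section Product

variable {C : Type*} [CommRing C] (lam : C) {A : Type*} [CommRing A] [Algebra C A]

theorem shuffleComponent_apply (m n l : ℕ) (x : ⨂[C]^(m + 1) A) (y : ⨂[C]^(n + 1) A) :
    shuffleComponent C lam A m n l x y =
      ∑ p ∈ mixableShuffles m n l, lam ^ (m + n - l) • (place C A p.1 x * place C A p.2 y) := by
  simp [shuffleComponent, LinearMap.sum_apply]

theorem shuffleComponent_eq_zero {m n l : ℕ} (h : ¬(m ≤ l ∧ n ≤ l ∧ l ≤ m + n))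
    (x : ⨂[C]^(m + 1) A) (y : ⨂[C]^(n + 1) A) : shuffleComponent C lam A m n l x y = 0 := by
  rw [shuffleComponent_apply]
  exact Finset.sum_eq_zero fun p hp => absurd (le_of_mem_mixableShuffles hp) h

theorem shuffleComponent_comm (m n l : ℕ) (x : ⨂[C]^(m + 1) A) (y : ⨂[C]^(n + 1) A) :
    shuffleComponent C lam A m n l x y = shuffleComponent C lam A n m l y x := by
  rw [shuffleComponent_apply, shuffleComponent_apply]
  refine Finset.sum_nbij' Prod.swap Prod.swap ?_ ?_ (by simp) (by simp) ?_
  · intro p; simp only [mem_mixableShuffles]; rintro ⟨h1, h2, h3⟩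
    exact ⟨h2, h1, fun j => (h3 j).symm⟩
  · intro p; simp only [mem_mixableShuffles]; rintro ⟨h1, h2, h3⟩
    exact ⟨h2, h1, fun j => (h3 j).symm⟩
  · intro p _
    simp [mul_comm, add_comm]

theorem shuffleComponent_one (n l : ℕ) (y : ⨂[C]^(n + 1) A) (h : l ≠ n) :
    shuffleComponent C lam A 0 n l 1 y = 0 :=
  shuffleComponent_eq_zero lam (by omega) _ _

theorem shuffleComponent_one_self (n : ℕ) (y : ⨂[C]^(n + 1) A) :
    shuffleComponent C lam A 0 n n 1 y = y := by
  rw [shuffleComponent_apply, Finset.sum_eq_single ((fun _ => 0), fun i => i)]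
  · simp [place_id]
  · rintro ⟨f, g⟩ hp hne
    exfalso
    obtain ⟨⟨hf, hf0⟩, ⟨hg, hg0⟩, hc⟩ := mem_mixableShuffles.1 hp
    apply hne
    have h1 : f = fun _ => 0 := by
      ext i
      rw [Fin.fin_one_eq_zero i]
      simpa using congrArg Fin.val hf0
    have h2 : g = fun i => i := by
      have : StrictMono g := hg
      funext i
      exact congrFun ((this.range_inj strictMono_id).1 (by
        rw [Set.range_id, Set.range_eq_univ]
        exact Finite.injective_iff_surjective.1 hg.injective)) i
    rw [h1, h2]
  · intro h
    exfalso
    apply h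
    rw [mem_mixableShuffles]
    refine ⟨⟨?_, rfl⟩, ⟨strictMono_id, rfl⟩, fun j => Or.inr ⟨j, rfl⟩⟩
    intro a b hab
    exact absurd hab (by rw [Fin.fin_one_eq_zero a, Fin.fin_one_eq_zero b]; simp)

open scoped Classical in
/-- Triples of position maps that use every position: the index set of a threefold product. -/
def mixableShuffles₃ (m n p l : ℕ) : Finset ((Fin (m + 1) → Fin (l + 1)) ×
    (Fin (n + 1) → Fin (l + 1)) × (Fin (p + 1) → Fin (l + 1))) :=
  {q | (StrictMono q.1 ∧ q.1 0 = 0) ∧ (StrictMono q.2.1 ∧ q.2.1 0 = 0) ∧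
    (StrictMono q.2.2 ∧ q.2.2 0 = 0) ∧
    ∀ j, (∃ i, q.1 i = j) ∨ (∃ i, q.2.1 i = j) ∨ ∃ i, q.2.2 i = j}

theorem sum_shuffleComponent (m n p l N : ℕ) (hN : m + n < N) (x : ⨂[C]^(m + 1) A)
    (y : ⨂[C]^(n + 1) A) (z : ⨂[C]^(p + 1) A) :
    ∑ k ∈ Finset.range N, shuffleComponent C lam A k p l (shuffleComponent C lam A m n k x y) z =
      ∑ q ∈ mixableShuffles₃ m n p l, lam ^ (m + n + p - l) •
        (place C A q.1 x * place C A q.2.1 y * place C A q.2.2 z) := by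
  have key : ∀ k, shuffleComponent C lam A k p l (shuffleComponent C lam A m n k x y) z =
      ∑ r ∈ mixableShuffles k p l ×ˢ mixableShuffles m n k, lam ^ (m + n + p - l) •
        (place C A (r.1.1 ∘ r.2.1) x * place C A (r.1.1 ∘ r.2.2) y * place C A r.1.2 z) := by
    intro k
    rw [shuffleComponent_apply, Finset.sum_product]
    refine Finset.sum_congr rfl fun r hr => ?_
    rw [shuffleComponent_apply, map_sum, Finset.sum_mul, Finset.smul_sum]
    refine Finset.sum_congr rfl fun s hs => ?_
    have h1 := le_of_mem_mixableShuffles hr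
    have h2 := le_of_mem_mixableShuffles hs
    rw [map_smul, map_mul, place_place, place_place, smul_mul_assoc, smul_smul, ← pow_add]
    congr 2
    omega
  rw [Finset.sum_congr rfl fun k _ => key k, Finset.sum_sigma']
  refine Finset.sum_nbij (fun t => (t.2.1.1 ∘ t.2.2.1, t.2.1.1 ∘ t.2.2.2, t.2.1.2))
    ?_ ?_ ?_ (fun _ _ => rfl)
  · rintro ⟨k, ⟨h, c⟩, f, g⟩ ht
    simp only [Finset.mem_sigma, Finset.mem_product, mem_mixableShuffles] at ht
    obtain ⟨-, ⟨⟨hh, hh0⟩, hc, hs⟩, ⟨hf, hf0⟩, ⟨hg, hg0⟩, hfg⟩ := ht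
    simp only [mixableShuffles₃, Finset.mem_filter, Finset.mem_univ, true_and]
    refine ⟨⟨hh.comp hf, by simp [hf0, hh0]⟩, ⟨hh.comp hg, by simp [hg0, hh0]⟩, hc, fun j => ?_⟩
    rcases hs j with ⟨i, hi⟩ | hi
    · rcases hfg i with ⟨a, ha⟩ | ⟨a, ha⟩
      · exact Or.inl ⟨a, by simp [ha, hi]⟩
      · exact Or.inr (Or.inl ⟨a, by simp [ha, hi]⟩)
    · exact Or.inr (Or.inr hi)
  · rintro ⟨k, ⟨h, c⟩, f, g⟩ ht ⟨k', ⟨h', c'⟩, f', g'⟩ ht' he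
    simp only [Finset.coe_sigma, Set.mem_sigma_iff, Finset.mem_coe, Finset.mem_product,
      mem_mixableShuffles] at ht ht'
    obtain ⟨-, ⟨⟨hh, hh0⟩, hc, hs⟩, ⟨hf, hf0⟩, ⟨hg, hg0⟩, hfg⟩ := ht
    obtain ⟨-, ⟨⟨hh', hh0'⟩, hc', hs'⟩, ⟨hf', hf0'⟩, ⟨hg', hg0'⟩, hfg'⟩ := ht'
    simp only [Prod.mk.injEq] at he
    obtain ⟨e1, e2, e3⟩ := he
    have hr : ∀ {k : ℕ} (h : Fin (k + 1) → Fin (l + 1)) (f : Fin (m + 1) → Fin (k + 1))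
        (g : Fin (n + 1) → Fin (k + 1)), (∀ j, (∃ i, f i = j) ∨ ∃ i, g i = j) →
        Set.range h = Set.range (h ∘ f) ∪ Set.range (h ∘ g) := by
      intro k h f g hfg
      ext j
      constructor
      · rintro ⟨i, rfl⟩
        rcases hfg i with ⟨a, rfl⟩ | ⟨a, rfl⟩
        · exact Or.inl ⟨a, rfl⟩
        · exact Or.inr ⟨a, rfl⟩
      · rintro (⟨a, rfl⟩ | ⟨a, rfl⟩)
        · exact ⟨_, rfl⟩
        · exact ⟨_, rfl⟩
    have hrr : Set.range h = Set.range h' := by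
      rw [hr h f g hfg, hr h' f' g' hfg', e1, e2]
    have hk : k = k' := by
      have h1 := Set.ncard_range_of_injective hh.injective
      have h2 := Set.ncard_range_of_injective hh'.injective
      rw [hrr, h2] at h1
      simpa using h1.symm
    subst hk
    have hhh : h = h' := (hh.range_inj hh').1 hrr
    subst hhh
    have e1' : f = f' := hh.injective.comp_left e1
    have e2' : g = g' := hh.injective.comp_left e2
    subst e1' e2' e3
    rfl
  · rintro ⟨F, G, c⟩ hq
    simp only [mixableShuffles₃, Finset.coe_filter, Finset.mem_univ, true_and,
      Set.mem_ofPred_eq] at hq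
    obtain ⟨⟨hF, hF0⟩, ⟨hG, hG0⟩, hc, hs⟩ := hq
    classical
    set S : Finset (Fin (l + 1)) := Finset.univ.image F ∪ Finset.univ.image G with hS
    have h0 : (0 : Fin (l + 1)) ∈ S := by
      rw [hS]; exact Finset.mem_union_left _ (Finset.mem_image.2 ⟨0, Finset.mem_univ _, hF0⟩)
    obtain ⟨k, hk⟩ : ∃ k, S.card = k + 1 :=
      ⟨S.card - 1, by have := Finset.card_pos.2 ⟨_, h0⟩; omega⟩
    set h := S.orderEmbOfFin hk with hh
    have hr : ∀ j ∈ S, ∃ i, h i = j := by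
      intro j hj
      have : j ∈ Set.range h := by rw [hh, Finset.range_orderEmbOfFin]; exact hj
      exact this
    have hFS : ∀ i, F i ∈ S := fun i => Finset.mem_union_left _ (Finset.mem_image_of_mem _ (by simp))
    have hGS : ∀ i, G i ∈ S := fun i =>
      Finset.mem_union_right _ (Finset.mem_image_of_mem _ (by simp))
    choose f hf using fun i => hr (F i) (hFS i)
    choose g hg using fun i => hr (G i) (hGS i)
    have hh0 : h 0 = 0 := by
      obtain ⟨i, hi⟩ := hr 0 h0
      apply le_antisymm _ (Fin.zero_le _)
      rw [← hi]
      exact h.monotone (Fin.zero_le _)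
    have hmem : (f, g) ∈ mixableShuffles m n k := by
      rw [mem_mixableShuffles]
      refine ⟨⟨?_, ?_⟩, ⟨?_, ?_⟩, ?_⟩
      · intro a b hab
        rw [← h.lt_iff_lt, hf, hf]; exact hF hab
      · apply h.injective; rw [hf, hF0, hh0]
      · intro a b hab
        rw [← h.lt_iff_lt, hg, hg]; exact hG hab
      · apply h.injective; rw [hg, hG0, hh0]
      · intro j
        have : h j ∈ S := Finset.orderEmbOfFin_mem S hk j
        rcases Finset.mem_union.1 this with h1 | h1
        · obtain ⟨i, -, hi⟩ := Finset.mem_image.1 h1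
          exact Or.inl ⟨i, h.injective (by rw [hf, hi])⟩
        · obtain ⟨i, -, hi⟩ := Finset.mem_image.1 h1
          exact Or.inr ⟨i, h.injective (by rw [hg, hi])⟩
    have hkl := le_of_mem_mixableShuffles hmem
    refine ⟨⟨k, (h, c), f, g⟩, ?_, ?_⟩
    · simp only [Finset.coe_sigma, Set.mem_sigma_iff, Finset.mem_coe, Finset.mem_product]
      refine ⟨Finset.mem_range.2 (by omega), mem_mixableShuffles.2 ⟨⟨h.strictMono, hh0⟩, hc, ?_⟩,
        hmem⟩
      intro j
      rcases hs j with ⟨i, hi⟩ | ⟨i, hi⟩ | hi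
      · exact Or.inl ⟨f i, by rw [← hi]; exact hf i⟩
      · exact Or.inl ⟨g i, by rw [← hi]; exact hg i⟩
      · exact Or.inr hi
    · simp only [Prod.mk.injEq, and_true]
      exact ⟨funext hf, funext hg⟩

theorem shuffleComponent_assoc (m n p l N : ℕ) (hN : m + n < N) (hN' : n + p < N)
    (x : ⨂[C]^(m + 1) A) (y : ⨂[C]^(n + 1) A) (z : ⨂[C]^(p + 1) A) :
    ∑ k ∈ Finset.range N, shuffleComponent C lam A k p l (shuffleComponent C lam A m n k x y) z =
      ∑ k ∈ Finset.range N,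
        shuffleComponent C lam A m k l x (shuffleComponent C lam A n p k y z) := by
  rw [Finset.sum_congr rfl fun k _ => shuffleComponent_comm lam m k l x _,
    sum_shuffleComponent lam m n p l N hN, sum_shuffleComponent lam n p m l N hN']
  refine Finset.sum_nbij' (fun q => (q.2.1, q.2.2, q.1)) (fun q => (q.2.2, q.1, q.2.1))
    ?_ ?_ (fun _ _ => rfl) (fun _ _ => rfl) ?_
  · intro q hq
    simp only [mixableShuffles₃, Finset.mem_filter, Finset.mem_univ, true_and] at hq ⊢
    exact ⟨hq.2.1, hq.2.2.1, hq.1, fun j => by have := hq.2.2.2 j; tauto⟩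
  · intro q hq
    simp only [mixableShuffles₃, Finset.mem_filter, Finset.mem_univ, true_and] at hq ⊢
    exact ⟨hq.2.2.1, hq.1, hq.2.1, fun j => by have := hq.2.2.2 j; tauto⟩
  · intro q _
    rw [mul_assoc, mul_comm (place C A q.1 x)]
    congr 2
    omega

theorem place_cons (m l : ℕ) (F : Fin m → Fin (l + 1)) (x : ⨂[C]^m A) :
    place C A (Fin.cons 0 F : Fin (m + 1) → Fin (l + 1)) (place C A Fin.succ x) =
      place C A F x := by
  rw [place_place]
  congr 1

open scoped Classical in
theorem shuffleComponent_succ_succ (m n l : ℕ) (x : ⨂[C]^(m + 1) A) (y : ⨂[C]^(n + 1) A) :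
    shuffleComponent C lam A (m + 1) (n + 1) (l + 1) (place C A Fin.succ x)
        (place C A Fin.succ y) =
      place C A Fin.succ (shuffleComponent C lam A m (n + 1) l x (place C A Fin.succ y)) +
      place C A Fin.succ (shuffleComponent C lam A n (m + 1) l y (place C A Fin.succ x)) +
      lam • place C A Fin.succ (shuffleComponent C lam A m n l x y) := by
  let G : Finset ((Fin (m + 1) → Fin (l + 1)) × (Fin (n + 1) → Fin (l + 1))) :=
    {p | StrictMono p.1 ∧ StrictMono p.2 ∧ ∀ j, (∃ i, p.1 i = j) ∨ ∃ i, p.2 i = j}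
  have hG : ∀ p, p ∈ G ↔
      StrictMono p.1 ∧ StrictMono p.2 ∧ ∀ j, (∃ i, p.1 i = j) ∨ ∃ i, p.2 i = j := by simp [G]
  clear_value G
  let w : ((Fin (m + 1) → Fin (l + 1)) × (Fin (n + 1) → Fin (l + 1))) → ⨂[C]^(l + 2) A :=
    fun p => lam ^ (m + n + 1 - l) • place C A Fin.succ (place C A p.1 x * place C A p.2 y)
  have hcons : ∀ {a b : ℕ} {F : Fin a → Fin (b + 1)}, StrictMono F → (∀ i, F i ≠ 0) →
      StrictMono (Fin.cons 0 F : Fin (a + 1) → Fin (b + 1)) := by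
    intro a b F hF h0 i j hij
    induction j using Fin.cases with
    | zero => exact absurd hij (Fin.not_lt_zero i)
    | succ j =>
      induction i using Fin.cases with
      | zero => simpa using Fin.pos_iff_ne_zero.2 (h0 j)
      | succ i => simpa using hF (Fin.succ_lt_succ_iff.1 hij)
  have hpos : ∀ {a b : ℕ} {F : Fin (a + 1) → Fin (b + 1)}, StrictMono F → F 0 ≠ 0 →
      ∀ i, F i ≠ 0 := by
    intro a b F hF h0 i
    exact Fin.pos_iff_ne_zero.1 ((Fin.pos_iff_ne_zero.2 h0).trans_le (hF.monotone (Fin.zero_le i)))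
  have e1 : shuffleComponent C lam A (m + 1) (n + 1) (l + 1) (place C A Fin.succ x)
      (place C A Fin.succ y) = ∑ p ∈ G, w p := by
    rw [shuffleComponent_apply]
    symm
    refine Finset.sum_nbij (fun p => ((Fin.cons 0 (Fin.succ ∘ p.1) : Fin (m + 2) → Fin (l + 2)),
      (Fin.cons 0 (Fin.succ ∘ p.2) : Fin (n + 2) → Fin (l + 2)))) ?_ ?_ ?_ ?_
    · rintro ⟨F, H⟩ hp
      obtain ⟨hF, hH, hs⟩ := (hG _).1 hp
      rw [mem_mixableShuffles]
      refine ⟨⟨hcons ((Fin.strictMono_succ).comp hF) fun i => Fin.succ_ne_zero _, rfl⟩,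
        ⟨hcons ((Fin.strictMono_succ).comp hH) fun i => Fin.succ_ne_zero _, rfl⟩, fun j => ?_⟩
      induction j using Fin.cases with
      | zero => exact Or.inl ⟨0, rfl⟩
      | succ j =>
        rcases hs j with ⟨i, hi⟩ | ⟨i, hi⟩
        · exact Or.inl ⟨i.succ, by simpa using hi⟩
        · exact Or.inr ⟨i.succ, by simpa using hi⟩
    · rintro ⟨F, H⟩ _ ⟨F', H'⟩ _ he
      simp only [Prod.mk.injEq, Fin.cons_inj, true_and] at he
      rw [(Fin.succ_injective _).comp_left he.1, (Fin.succ_injective _).comp_left he.2]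
    · rintro ⟨f, g⟩ hp
      obtain ⟨⟨hf, hf0⟩, ⟨hg, hg0⟩, hc⟩ := mem_mixableShuffles.1 (Finset.mem_coe.1 hp)
      have hf1 : ∀ i : Fin (m + 1), f i.succ ≠ 0 := fun i =>
        Fin.pos_iff_ne_zero.1 (by rw [← hf0]; exact hf (Fin.succ_pos i))
      have hg1 : ∀ i : Fin (n + 1), g i.succ ≠ 0 := fun i =>
        Fin.pos_iff_ne_zero.1 (by rw [← hg0]; exact hg (Fin.succ_pos i))
      choose F hF using fun i => Fin.exists_succ_eq.2 (hf1 i)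
      choose H hH using fun i => Fin.exists_succ_eq.2 (hg1 i)
      refine ⟨(F, H), Finset.mem_coe.2 ((hG _).2 ⟨?_, ?_, ?_⟩), ?_⟩
      · intro a b hab
        rw [← Fin.succ_lt_succ_iff, hF, hF]; exact hf (Fin.succ_lt_succ_iff.2 hab)
      · intro a b hab
        rw [← Fin.succ_lt_succ_iff, hH, hH]; exact hg (Fin.succ_lt_succ_iff.2 hab)
      · intro j
        rcases hc j.succ with ⟨i, hi⟩ | ⟨i, hi⟩
        · induction i using Fin.cases with
          | zero => exact absurd (hi.symm.trans hf0) (Fin.succ_ne_zero j)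
          | succ i => exact Or.inl ⟨i, Fin.succ_injective _ ((hF i).trans hi)⟩
        · induction i using Fin.cases with
          | zero => exact absurd (hi.symm.trans hg0) (Fin.succ_ne_zero j)
          | succ i => exact Or.inr ⟨i, Fin.succ_injective _ ((hH i).trans hi)⟩
      · simp only [Prod.mk.injEq]
        constructor
        · funext i
          induction i using Fin.cases with
          | zero => exact hf0.symm
          | succ i => simp [hF]
        · funext i
          induction i using Fin.cases with
          | zero => exact hg0.symm
          | succ i => simp [hH]
    · rintro ⟨F, H⟩ _
      simp only [w, map_mul, place_place]
      congr 2
      omega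
  have e2 : place C A Fin.succ (shuffleComponent C lam A m (n + 1) l x (place C A Fin.succ y)) =
      ∑ p ∈ G with p.1 0 = 0 ∧ p.2 0 ≠ 0, w p := by
    rw [shuffleComponent_apply, map_sum]
    symm
    refine Finset.sum_nbij (fun p => (p.1, (Fin.cons 0 p.2 : Fin (n + 2) → Fin (l + 1))))
      ?_ ?_ ?_ ?_
    · rintro ⟨F, H⟩ hp
      obtain ⟨hp, hF0, hH0⟩ := Finset.mem_filter.1 hp
      obtain ⟨hF, hH, hs⟩ := (hG _).1 hp
      rw [mem_mixableShuffles]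
      refine ⟨⟨hF, hF0⟩, ⟨hcons hH (hpos hH hH0), rfl⟩, fun j => ?_⟩
      rcases hs j with hi | ⟨i, hi⟩
      · exact Or.inl hi
      · exact Or.inr ⟨i.succ, by simpa using hi⟩
    · rintro ⟨F, H⟩ _ ⟨F', H'⟩ _ he
      simpa only [Prod.mk.injEq, Fin.cons_inj, true_and] using he
    · rintro ⟨f, g⟩ hp
      obtain ⟨⟨hf, hf0⟩, ⟨hg, hg0⟩, hc⟩ := mem_mixableShuffles.1 (Finset.mem_coe.1 hp)
      refine ⟨(f, Fin.tail g), Finset.mem_coe.2 (Finset.mem_filter.2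
        ⟨(hG _).2 ⟨hf, ?_, ?_⟩, hf0, ?_⟩), ?_⟩
      · intro a b hab
        exact hg (Fin.succ_lt_succ_iff.2 hab)
      · intro j
        rcases hc j with hi | ⟨i, hi⟩
        · exact Or.inl hi
        · induction i using Fin.cases with
          | zero => exact Or.inl ⟨0, by rw [← hi]; exact hf0.trans hg0.symm⟩
          | succ i => exact Or.inr ⟨i, hi⟩
      · have : g 0 < g 1 := hg (Fin.zero_lt_one)
        rw [show g 0 = 0 from hg0] at this
        exact Fin.pos_iff_ne_zero.1 this
      · simp only [Prod.mk.injEq, true_and]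
        rw [← hg0]
        exact Fin.cons_self_tail g
    · rintro ⟨F, H⟩ _
      simp only [w, place_cons, map_smul]
      rfl
  have e3 : place C A Fin.succ (shuffleComponent C lam A n (m + 1) l y (place C A Fin.succ x)) =
      ∑ p ∈ G with p.1 0 ≠ 0 ∧ p.2 0 = 0, w p := by
    rw [shuffleComponent_apply, map_sum]
    symm
    refine Finset.sum_nbij (fun p => (p.2, (Fin.cons 0 p.1 : Fin (m + 2) → Fin (l + 1))))
      ?_ ?_ ?_ ?_
    · rintro ⟨F, H⟩ hp
      obtain ⟨hp, hF0, hH0⟩ := Finset.mem_filter.1 hp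
      obtain ⟨hF, hH, hs⟩ := (hG _).1 hp
      rw [mem_mixableShuffles]
      refine ⟨⟨hH, hH0⟩, ⟨hcons hF (hpos hF hF0), rfl⟩, fun j => ?_⟩
      rcases hs j with ⟨i, hi⟩ | hi
      · exact Or.inr ⟨i.succ, by simpa using hi⟩
      · exact Or.inl hi
    · rintro ⟨F, H⟩ _ ⟨F', H'⟩ _ he
      simp only [Prod.mk.injEq, Fin.cons_inj, true_and] at he
      rw [he.1, he.2]
    · rintro ⟨f, g⟩ hp
      obtain ⟨⟨hf, hf0⟩, ⟨hg, hg0⟩, hc⟩ := mem_mixableShuffles.1 (Finset.mem_coe.1 hp)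
      refine ⟨(Fin.tail g, f), Finset.mem_coe.2 (Finset.mem_filter.2
        ⟨(hG _).2 ⟨?_, hf, ?_⟩, ?_, hf0⟩), ?_⟩
      · intro a b hab
        exact hg (Fin.succ_lt_succ_iff.2 hab)
      · intro j
        rcases hc j with hi | ⟨i, hi⟩
        · exact Or.inr hi
        · induction i using Fin.cases with
          | zero => exact Or.inr ⟨0, by rw [← hi]; exact hf0.trans hg0.symm⟩
          | succ i => exact Or.inl ⟨i, hi⟩
      · have : g 0 < g 1 := hg (Fin.zero_lt_one)
        rw [show g 0 = 0 from hg0] at this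
        exact Fin.pos_iff_ne_zero.1 this
      · simp only [Prod.mk.injEq, true_and]
        rw [← hg0]
        exact Fin.cons_self_tail g
    · rintro ⟨F, H⟩ _
      simp only [w, place_cons, map_smul]
      rw [mul_comm (place C A F x)]
      congr 2
      omega
  have e4 : lam • place C A Fin.succ (shuffleComponent C lam A m n l x y) =
      ∑ p ∈ G with p.1 0 = 0 ∧ p.2 0 = 0, w p := by
    rw [shuffleComponent_apply, map_sum, Finset.smul_sum]
    refine Finset.sum_congr ?_ ?_
    · ext p
      rw [mem_mixableShuffles, Finset.mem_filter, hG]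
      tauto
    · intro p hp
      have h1 : p ∈ mixableShuffles m n l := by
        rw [Finset.mem_filter, hG] at hp
        rw [mem_mixableShuffles]
        tauto
      have := le_of_mem_mixableShuffles h1
      simp only [w, map_smul, smul_smul]
      rw [← pow_succ']
      congr 2
      omega
  rw [e1, e2, e3, e4, ← Finset.sum_filter_add_sum_filter_not G (fun p => p.1 0 = 0),
    ← Finset.sum_filter_add_sum_filter_not (G.filter fun p => p.1 0 = 0) (fun p => p.2 0 = 0),
    Finset.filter_filter _ _ G, Finset.filter_filter _ _ G]
  have h5 : (G.filter fun p => ¬p.1 0 = 0) = G.filter fun p => p.1 0 ≠ 0 ∧ p.2 0 = 0 := by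
    refine Finset.filter_congr fun p hp => ?_
    obtain ⟨hF, hH, hs⟩ := (hG _).1 hp
    refine ⟨fun h => ⟨h, ?_⟩, fun h => h.1⟩
    rcases hs 0 with ⟨i, hi⟩ | ⟨i, hi⟩
    · exact absurd hi (hpos hF h i)
    · by_contra h'
      exact hpos hH h' i hi
  rw [h5]
  abel

end Product

/-- The shuffle Baxter algebra `Ш_C(A) = ⨁ₙ A^{⊗(n+1)}` of weight `lam`, with the mixed shuffle
product (below). -/
def Sha (C : Type*) [CommRing C] (_lam : C) (A : Type*) [CommRing A] [Algebra C A] : Type _ :=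
  ⨁ n : ℕ, ⨂[C]^(n + 1) A

namespace Sha

variable (C : Type*) [CommRing C] (lam : C) (A : Type*) [CommRing A] [Algebra C A]

instance : AddCommGroup (Sha C lam A) :=
  inferInstanceAs (AddCommGroup (⨁ n : ℕ, ⨂[C]^(n + 1) A))

instance : Module C (Sha C lam A) :=
  inferInstanceAs (Module C (⨁ n : ℕ, ⨂[C]^(n + 1) A))

/-- The inclusion of `Ш^n_C(A) = A^{⊗(n+1)}`. -/
def of (n : ℕ) : (⨂[C]^(n + 1) A) →ₗ[C] Sha C lam A :=
  DirectSum.lof C ℕ (fun n => ⨂[C]^(n + 1) A) n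

/-- The projection to `Ш^n_C(A) = A^{⊗(n+1)}`. -/
def proj (n : ℕ) : Sha C lam A →ₗ[C] (⨂[C]^(n + 1) A) :=
  DirectSum.component C ℕ (fun n => ⨂[C]^(n + 1) A) n

variable {C A} in
/-- Linear maps out of `Ш_C(A)` are given componentwise. -/
def lift {N : Type*} [AddCommGroup N] [Module C N] (f : ∀ n : ℕ, (⨂[C]^(n + 1) A) →ₗ[C] N) :
    Sha C lam A →ₗ[C] N :=
  DirectSum.toModule C ℕ N f

variable {C A} in
theorem lift_of {N : Type*} [AddCommGroup N] [Module C N]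
    (f : ∀ n : ℕ, (⨂[C]^(n + 1) A) →ₗ[C] N) (n : ℕ) (x : ⨂[C]^(n + 1) A) :
    lift lam f (of C lam A n x) = f n x :=
  DirectSum.toModule_lof ..

/-- The mixed shuffle product as a bilinear map: on `A^{⊗(m+1)} × A^{⊗(n+1)}` it is the sum over
all mixable shuffles, sorted by the degree `l ≤ m + n` of the result. -/
def mulBilin : Sha C lam A →ₗ[C] Sha C lam A →ₗ[C] Sha C lam A :=
  lift lam fun m => LinearMap.flip <| lift lam fun n =>
    LinearMap.flip <| ∑ l ∈ Finset.range (m + n + 1),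
      (shuffleComponent C lam A m n l).compr₂ (of C lam A l)

instance : Mul (Sha C lam A) := ⟨fun x y => mulBilin C lam A x y⟩

instance : One (Sha C lam A) := ⟨of C lam A 0 1⟩

variable {C A}

theorem mul_def (x y : Sha C lam A) : x * y = mulBilin C lam A x y := rfl

theorem one_def : (1 : Sha C lam A) = of C lam A 0 1 := rfl

theorem of_mul_of (m n : ℕ) (x : ⨂[C]^(m + 1) A) (y : ⨂[C]^(n + 1) A) :
    of C lam A m x * of C lam A n y =
      ∑ l ∈ Finset.range (m + n + 1), of C lam A l (shuffleComponent C lam A m n l x y) := by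
  rw [mul_def, mulBilin, lift_of, LinearMap.flip_apply, lift_of]
  simp [LinearMap.sum_apply]

theorem of_mul_of' (m n N : ℕ) (hN : m + n < N) (x : ⨂[C]^(m + 1) A) (y : ⨂[C]^(n + 1) A) :
    of C lam A m x * of C lam A n y =
      ∑ l ∈ Finset.range N, of C lam A l (shuffleComponent C lam A m n l x y) := by
  rw [of_mul_of]
  refine Finset.sum_subset (Finset.range_subset_range.2 hN) fun l _ hl => ?_
  rw [shuffleComponent_eq_zero _ (by simp at hl; omega), map_zero]

theorem proj_of (m n : ℕ) (x : ⨂[C]^(m + 1) A) :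
    proj C lam A n (of C lam A m x) = if h : m = n then h ▸ x else 0 :=
  DirectSum.component.of ..

theorem proj_of_self (n : ℕ) (x : ⨂[C]^(n + 1) A) : proj C lam A n (of C lam A n x) = x := by
  simp [proj_of]

theorem proj_of_ne {m n : ℕ} (h : m ≠ n) (x : ⨂[C]^(m + 1) A) :
    proj C lam A n (of C lam A m x) = 0 := by
  simp [proj_of, h]

theorem ext {x y : Sha C lam A} (h : ∀ n, proj C lam A n x = proj C lam A n y) : x = y :=
  DirectSum.ext_component C h

theorem hom_ext {N : Type*} [AddCommGroup N] [Module C N] {f g : Sha C lam A →ₗ[C] N}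
    (h : ∀ n x, f (of C lam A n x) = g (of C lam A n x)) : f = g :=
  DirectSum.linearMap_ext C fun n => LinearMap.ext fun x => h n x

theorem induction {p : Sha C lam A → Prop} (hof : ∀ n x, p (of C lam A n x))
    (hadd : ∀ x y, p x → p y → p (x + y)) (x : Sha C lam A) : p x := by
  refine DirectSum.induction_on x ?_ hof hadd
  have := hof 0 0
  rwa [map_zero] at this

protected theorem add_mul (x y z : Sha C lam A) : (x + y) * z = x * z + y * z := by
  simp [mul_def]

protected theorem mul_add (x y z : Sha C lam A) : x * (y + z) = x * y + x * z := by
  simp [mul_def]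

protected theorem mul_comm (x y : Sha C lam A) : x * y = y * x := by
  induction x using induction with
  | hadd a b ha hb => rw [Sha.add_mul, Sha.mul_add, ha, hb]
  | hof m x =>
    induction y using induction with
    | hadd a b ha hb => rw [Sha.add_mul, Sha.mul_add, ha, hb]
    | hof n y =>
      rw [of_mul_of, of_mul_of, add_comm m n]
      exact Finset.sum_congr rfl fun l _ => by rw [shuffleComponent_comm]

protected theorem one_mul (x : Sha C lam A) : 1 * x = x := by
  induction x using induction with
  | hadd a b ha hb => rw [Sha.mul_add, ha, hb]
  | hof n x =>
    rw [one_def, of_mul_of, Finset.sum_eq_single n]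
    · rw [shuffleComponent_one_self]
    · intro l _ hl
      rw [shuffleComponent_one _ _ _ _ hl, map_zero]
    · simp

protected theorem mul_assoc (x y z : Sha C lam A) : x * y * z = x * (y * z) := by
  induction x using induction with
  | hadd a b ha hb => simp only [Sha.add_mul, ha, hb]
  | hof m x =>
    induction y using induction with
    | hadd a b ha hb => simp only [Sha.add_mul, Sha.mul_add, ha, hb]
    | hof n y =>
      induction z using induction with
      | hadd a b ha hb => simp only [Sha.mul_add, ha, hb]
      | hof p z =>
        have hs : ∀ (N : ℕ) (f : ℕ → Sha C lam A) (w : Sha C lam A),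
            (∑ i ∈ Finset.range N, f i) * w = ∑ i ∈ Finset.range N, f i * w := by
          intro N f w; simp [mul_def, LinearMap.sum_apply]
        have hs' : ∀ (N : ℕ) (f : ℕ → Sha C lam A) (w : Sha C lam A),
            w * (∑ i ∈ Finset.range N, f i) = ∑ i ∈ Finset.range N, w * f i := by
          intro N f w; simp [mul_def]
        have ha : of C lam A m x * of C lam A n y * of C lam A p z =
            ∑ l ∈ Finset.range (m + n + p + 1), of C lam A l (∑ k ∈ Finset.range (m + n + p + 1),
              shuffleComponent C lam A k p l (shuffleComponent C lam A m n k x y) z) := by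
          rw [of_mul_of, hs]
          rw [Finset.sum_congr rfl fun k hk => of_mul_of' lam k p (m + n + p + 1)
            (by simp at hk; omega) _ _, Finset.sum_comm]
          refine Finset.sum_congr rfl fun l _ => ?_
          rw [map_sum]
          refine Finset.sum_subset (Finset.range_subset_range.2 (by omega)) fun k _ hk => ?_
          rw [shuffleComponent_eq_zero _ (by simp at hk; omega) x y]
          simp
        have hb : of C lam A m x * (of C lam A n y * of C lam A p z) =
            ∑ l ∈ Finset.range (m + n + p + 1), of C lam A l (∑ k ∈ Finset.range (m + n + p + 1),
              shuffleComponent C lam A m k l x (shuffleComponent C lam A n p k y z)) := by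
          rw [of_mul_of lam n p, hs']
          rw [Finset.sum_congr rfl fun k hk => of_mul_of' lam m k (m + n + p + 1)
            (by simp at hk; omega) _ _, Finset.sum_comm]
          refine Finset.sum_congr rfl fun l _ => ?_
          rw [map_sum]
          refine Finset.sum_subset (Finset.range_subset_range.2 (by omega)) fun k _ hk => ?_
          rw [shuffleComponent_eq_zero _ (by simp at hk; omega) y z]
          simp
        rw [ha, hb]
        exact Finset.sum_congr rfl fun l _ => by
          rw [shuffleComponent_assoc _ m n p l _ (by omega) (by omega)]

instance : CommRing (Sha C lam A) where
  __ := (inferInstance : AddCommGroup (Sha C lam A))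
  mul_assoc := Sha.mul_assoc lam
  one_mul := Sha.one_mul lam
  mul_one x := by rw [Sha.mul_comm, Sha.one_mul]
  mul_comm := Sha.mul_comm lam
  left_distrib := Sha.mul_add lam
  right_distrib := Sha.add_mul lam
  zero_mul x := by simp [mul_def]
  mul_zero x := by simp [mul_def]

instance : Algebra C (Sha C lam A) :=
  Algebra.ofModule (fun r x y => by simp [mul_def]) (fun r x y => by simp [mul_def])

theorem proj_mul (l : ℕ) (x y : Sha C lam A) : proj C lam A l (x * y) =
    ∑ m ∈ Finset.range (l + 1), ∑ n ∈ Finset.range (l + 1),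
      shuffleComponent C lam A m n l (proj C lam A m x) (proj C lam A n y) := by
  induction x using induction with
  | hadd a b ha hb => simp only [add_mul, map_add, ha, hb, LinearMap.add_apply,
      Finset.sum_add_distrib]
  | hof m x =>
    induction y using induction with
    | hadd a b ha hb => simp only [mul_add, map_add, ha, hb, Finset.sum_add_distrib]
    | hof n y =>
      have h1 : proj C lam A l (of C lam A m x * of C lam A n y) =
          shuffleComponent C lam A m n l x y := by
        rw [of_mul_of' lam m n (m + n + l + 1) (by omega), map_sum, Finset.sum_eq_single l]
        · rw [proj_of_self]
        · intro k _ hk; exact proj_of_ne _ hk _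
        · intro h; exact absurd (Finset.mem_range.2 (by omega)) h
      rw [h1, Finset.sum_eq_single m, Finset.sum_eq_single n]
      · rw [proj_of_self, proj_of_self]
      · intro k _ hk; rw [proj_of_ne _ hk.symm, map_zero]
      · intro h; rw [shuffleComponent_eq_zero]; simp at h; omega
      · intro k _ hk
        refine Finset.sum_eq_zero fun k' _ => ?_
        rw [proj_of_ne _ hk.symm, map_zero, LinearMap.zero_apply]
      · intro h
        refine Finset.sum_eq_zero fun k' _ => ?_
        rw [shuffleComponent_eq_zero]; simp at h; omega

variable (C A)

/-- The Baxter operator `x₀ ⊗ ⋯ ⊗ xₙ ↦ 1 ⊗ x₀ ⊗ ⋯ ⊗ xₙ`. -/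
def baxterOp : Sha C lam A →ₗ[C] Sha C lam A :=
  lift lam fun n => (of C lam A (n + 1)).comp (place C A Fin.succ).toLinearMap

variable {C A} in
theorem baxterOp_of (n : ℕ) (x : ⨂[C]^(n + 1) A) :
    baxterOp C lam A (of C lam A n x) = of C lam A (n + 1) (place C A Fin.succ x) := by
  simp [baxterOp, lift_of]

variable {C A} in
theorem baxterOp_tprod (n : ℕ) (x : Fin (n + 1) → A) :
    baxterOp C lam A (of C lam A n (PiTensorProduct.tprod C x)) =
      of C lam A (n + 1) (PiTensorProduct.tprod C (Fin.cons 1 x : Fin (n + 2) → A)) := by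
  rw [baxterOp_of, place_tprod]
  congr 2
  funext j
  induction j using Fin.cases with
  | zero => simp [Fin.succ_ne_zero]
  | succ j => simp [Finset.prod_filter]

variable {C A} in
/-- `baxterOp` is a Baxter operator of weight `lam`. -/
theorem baxterOp_mul_baxterOp (x y : Sha C lam A) :
    baxterOp C lam A x * baxterOp C lam A y =
      baxterOp C lam A (x * baxterOp C lam A y) + baxterOp C lam A (y * baxterOp C lam A x) +
        lam • baxterOp C lam A (x * y) := by
  induction x using induction with
  | hadd a b ha hb => simp only [add_mul, mul_add, map_add, smul_add, ha, hb]; abel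
  | hof m x =>
    induction y using induction with
    | hadd a b ha hb => simp only [add_mul, mul_add, map_add, smul_add, ha, hb]; abel
    | hof n y =>
      rw [baxterOp_of, baxterOp_of, of_mul_of' lam (m + 1) (n + 1) (m + n + 2 + 1) (by omega),
        of_mul_of' lam m (n + 1) (m + n + 2) (by omega),
        of_mul_of' lam n (m + 1) (m + n + 2) (by omega),
        of_mul_of' lam m n (m + n + 2) (by omega), Finset.sum_range_succ',
        shuffleComponent_eq_zero lam (by omega), map_zero, add_zero]
      simp only [map_sum, Finset.smul_sum, ← Finset.sum_add_distrib, baxterOp_of, ← map_smul,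
        ← map_add]
      exact Finset.sum_congr rfl fun l _ => by
        rw [shuffleComponent_succ_succ]; simp only [map_add, map_smul]

/-- The ideal `Fil^k Ш_C(A) = ⨁_{n ≥ k} Ш^n_C(A)`. -/
def fil (k : ℕ) : Ideal (Sha C lam A) where
  carrier := {x | ∀ n < k, proj C lam A n x = 0}
  zero_mem' n _ := map_zero _
  add_mem' {x y} hx hy n hn := by rw [map_add, hx n hn, hy n hn, add_zero]
  smul_mem' x y hy n hn := by
    rw [smul_eq_mul, proj_mul]
    refine Finset.sum_eq_zero fun i _ => Finset.sum_eq_zero fun j hj => ?_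
    rw [hy j (by simp at hj; omega), map_zero]

theorem fil_antitone : Antitone (fil C lam A) := fun _ _ h _ hx n hn => hx n (hn.trans_le h)

end Sha

/-- The complete shuffle Baxter algebra `lim_k Ш_C(A) / Fil^k Ш_C(A)` of weight `lam`: the
subalgebra of compatible families in `∏_k Ш_C(A) / Fil^k Ш_C(A)`. -/
def CompleteSha (C : Type*) [CommRing C] (lam : C) (A : Type*) [CommRing A] [Algebra C A] :
    Subalgebra C (∀ k : ℕ, Sha C lam A ⧸ Sha.fil C lam A k) where
  carrier := {x | ∀ k l (h : k ≤ l),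
    Ideal.Quotient.factor (Sha.fil_antitone C lam A h) (x l) = x k}
  mul_mem' {x y} hx hy k l h := by simp only [Pi.mul_apply, map_mul, hx k l h, hy k l h]
  add_mem' {x y} hx hy k l h := by simp only [Pi.add_apply, map_add, hx k l h, hy k l h]
  algebraMap_mem' _ _ _ _ := rfl

/-- The complete free Baxter `C`-algebra of weight `lam` on the set `X`: the complete shuffle
Baxter algebra on the polynomial algebra `C[X]`. -/
abbrev CompleteFreeBaxter (C : Type*) [CommRing C] (lam : C) (X : Type*) :=
  CompleteSha C lam (MvPolynomial X C)

end Baxter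

end

namespace Baxter

/-! ### Lexicographic leading terms under order-preserving renamings -/

section LeadingTerms

open MvPolynomial MonomialOrder

variable {R : Type*} [CommRing R]

/-! Write the component in `A^{⊗(n+1)}` as a polynomial in `n + 1` copies of the variables; placing
tensor factors into slots becomes a renaming of variables.

In weight `0` over a domain of characteristic zero, let `m` and `n` be the lowest degrees of two
nonzero elements. The component of the product in degree `m + n` is the sum over the plain shuffles
of the two lowest components. Strictly increasing renamings preserve the lex order, so all summands
have the same leading coefficient `c ≠ 0`; the largest monomial occurs in the sum with a positive
integer multiple of `c`, hence nothing cancels (`shuffleMul_zero_ne_zero`).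

A nonunit weight `lam` is reduced to weight `0`. Localize at a maximal ideal containing `lam`, which
gives a unique factorization domain. If `lam ≠ 0` there, take a prime `p ∣ lam`, divide both factors
by their largest powers of `p`, and reduce modulo `p`: the factors stay nonzero, the quotient is a
domain containing `ℚ`, and the weight becomes `0`.

If `lam` is a unit, put `uₙ = 1 ⊗ ⋯ ⊗ 1` in degree `n`. From `u₁ uₙ = (n + 1) uₙ₊₁ + lam n uₙ` the
product of `u₁` with `∑ cⁿ uₙ`, `c = -lam⁻¹`, telescopes to zero, although neither factor is zero.
-/

theorem toLex_mapDomain_strictMono {σ τ : Type*} [LinearOrder σ] [LinearOrder τ] {e : σ → τ}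
    (he : StrictMono e) {u v : σ →₀ ℕ} (h : toLex u < toLex v) :
    toLex (u.mapDomain e) < toLex (v.mapDomain e) := by
  obtain ⟨i, hi, hlt⟩ := h
  refine ⟨e i, fun j hj => ?_, ?_⟩
  · change u.mapDomain e j = v.mapDomain e j
    by_cases hr : j ∈ Set.range e
    · obtain ⟨k, rfl⟩ := hr
      rw [Finsupp.mapDomain_apply he.injective, Finsupp.mapDomain_apply he.injective]
      exact hi k (he.lt_iff_lt.1 hj)
    · rw [Finsupp.mapDomain_of_notMem_range _ _ hr, Finsupp.mapDomain_of_notMem_range _ _ hr]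
  · change u.mapDomain e (e i) < v.mapDomain e (e i)
    rw [Finsupp.mapDomain_apply he.injective, Finsupp.mapDomain_apply he.injective]
    exact hlt

/-- Every exponent of the renamed polynomial is the image of an exponent of `x`, and the order of
exponents is preserved, so the largest one goes to the largest one. -/
theorem degree_rename {σ τ : Type*} [LinearOrder σ] [LinearOrder τ] [WellFoundedGT σ]
    [WellFoundedGT τ] {e : σ → τ} (he : StrictMono e) (x : MvPolynomial σ R) :
    lex.degree (rename e x) = (lex.degree x).mapDomain e := by
  by_cases hx : x = 0
  · simp [hx]
  apply lex.toSyn.injective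
  apply le_antisymm
  · rw [degree_le_iff]
    intro d hd
    obtain ⟨u, rfl, hu⟩ := coeff_rename_ne_zero _ _ _ (mem_support_iff.1 hd)
    have h := lex.le_degree (mem_support_iff.2 hu)
    rw [lex_le_iff] at h ⊢
    rcases h.eq_or_lt with h | h
    · rw [toLex.injective h]
    · exact (toLex_mapDomain_strictMono he h).le
  · apply lex.le_degree
    rw [mem_support_iff, coeff_rename_mapDomain _ he.injective]
    exact coeff_degree_ne_zero_iff.2 hx

theorem leadingCoeff_rename {σ τ : Type*} [LinearOrder σ] [LinearOrder τ] [WellFoundedGT σ]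
    [WellFoundedGT τ] {e : σ → τ} (he : StrictMono e) (x : MvPolynomial σ R) :
    lex.leadingCoeff (rename e x) = lex.leadingCoeff x := by
  rw [leadingCoeff, degree_rename he, coeff_rename_mapDomain _ he.injective, leadingCoeff]

/-- At the largest degree among the summands each contributes either `c` or `0`, so the coefficient
of the sum is a positive integer times `c`. The degrees themselves may differ. -/
theorem sum_ne_zero_of_leadingCoeff_eq [IsDomain R] [CharZero R] {ι τ : Type*}
    (o : MonomialOrder τ) {s : Finset ι} (hs : s.Nonempty) {F : ι → MvPolynomial τ R} {c : R}
    (hc : c ≠ 0) (hF : ∀ i ∈ s, o.leadingCoeff (F i) = c) : ∑ i ∈ s, F i ≠ 0 := by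
  classical
  obtain ⟨a, ha, hmax⟩ := s.exists_max_image (fun i => o.toSyn (o.degree (F i))) hs
  intro h0
  have h1 := congrArg (coeff (o.degree (F a))) h0
  have h2 : ∀ i ∈ s, coeff (o.degree (F a)) (F i) =
      if o.degree (F i) = o.degree (F a) then c else 0 := by
    intro i hi
    split_ifs with h
    · rw [← h]; exact hF i hi
    · exact o.coeff_eq_zero_of_lt
        (lt_of_le_of_ne (hmax i hi) fun h' => h (o.toSyn.injective h'))
  rw [coeff_sum, Finset.sum_congr rfl h2, ← Finset.sum_filter, Finset.sum_const, coeff_zero,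
    nsmul_eq_mul, mul_eq_zero, Nat.cast_eq_zero, Finset.card_eq_zero] at h1
  rcases h1 with h1 | h1
  · exact Finset.notMem_empty a (h1 ▸ Finset.mem_filter.2 ⟨ha, rfl⟩)
  · exact hc h1

theorem sum_rename_mul_rename_ne_zero [IsDomain R] [CharZero R] {ι σ σ' τ : Type*}
    [LinearOrder σ] [LinearOrder σ'] [LinearOrder τ] [WellFoundedGT σ] [WellFoundedGT σ']
    [WellFoundedGT τ] {s : Finset ι} (hs : s.Nonempty) {e : ι → σ → τ} {e' : ι → σ' → τ}
    (he : ∀ i ∈ s, StrictMono (e i)) (he' : ∀ i ∈ s, StrictMono (e' i))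
    {x : MvPolynomial σ R} {y : MvPolynomial σ' R} (hx : x ≠ 0) (hy : y ≠ 0) :
    ∑ i ∈ s, rename (e i) x * rename (e' i) y ≠ 0 := by
  refine sum_ne_zero_of_leadingCoeff_eq lex hs
    (c := lex.leadingCoeff x * lex.leadingCoeff y)
    (mul_ne_zero (leadingCoeff_ne_zero_iff.2 hx) (leadingCoeff_ne_zero_iff.2 hy)) fun i hi => ?_
  rw [leadingCoeff_mul, leadingCoeff_rename (he i hi), leadingCoeff_rename (he' i hi)]

end LeadingTerms

section Orders

/-- The lex monomial order on possibly infinitely many variables needs an order without infinite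
ascending chains; the reverse of a well-order is one. -/
theorem exists_linearOrder_wellFoundedGT (X : Type*) : ∃ _ : LinearOrder X, WellFoundedGT X := by
  obtain ⟨_, h⟩ := exists_wellFoundedLT X
  exact ⟨LinearOrder.lift' (OrderDual.toDual : X → Xᵒᵈ) OrderDual.toDual.injective, ⟨h.wf⟩⟩

theorem wellFoundedGT_prodLex (α β : Type*) [LinearOrder α] [LinearOrder β] [WellFoundedGT α]
    [WellFoundedGT β] : WellFoundedGT (α ×ₗ β) := by
  refine ⟨Subrelation.wf (r := InvImage (Prod.Lex (· > ·) (· > ·)) ofLex) ?_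
    (InvImage.wf _ ((wellFounded_gt (α := α)).prod_lex (wellFounded_gt (α := β))))⟩
  intro a b h
  rcases Prod.Lex.lt_iff.1 h with h | ⟨h, h'⟩
  · exact Prod.lex_def.2 (Or.inl h)
  · exact Prod.lex_def.2 (Or.inr ⟨h.symm, h'⟩)

end Orders

/-! ### Absence of zero divisors in the polynomial model -/

section Sequences

open MvPolynomial

variable {X : Type*} {R : Type*} [CommRing R]

/-- The renaming of variables belonging to a map of slots. -/
def slot {m l : ℕ} (f : Fin m → Fin l) (s : Fin m ×ₗ X) : Fin l ×ₗ X :=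
  toLex (f (ofLex s).1, (ofLex s).2)

/-- This is why the variables are indexed by the lexicographic product: slots are compared first, so
keeping the order of the letters of a word keeps the order of the variables. -/
theorem slot_strictMono [LinearOrder X] {m l : ℕ} {f : Fin m → Fin l} (hf : StrictMono f) :
    StrictMono (slot f : Fin m ×ₗ X → Fin l ×ₗ X) := by
  intro a b h
  rw [Prod.Lex.lt_iff] at h
  rcases h with h | ⟨h, h'⟩
  · exact Prod.Lex.lt_iff.2 (Or.inl (hf h))
  · exact Prod.Lex.lt_iff.2 (Or.inr ⟨congrArg f h, h'⟩)

/-- Elements of the complete shuffle algebra on `R[X]`, the component in `R[X]^{⊗(n+1)}` being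
written as a polynomial in `n + 1` copies of the variables. -/
abbrev PolySeq (X R : Type*) [CommRing R] := ∀ n : ℕ, MvPolynomial (Fin (n + 1) ×ₗ X) R

/-- The mixed shuffle product of weight `lam` in terms of polynomials. -/
noncomputable def shuffleMul (lam : R) (x y : PolySeq X R) : PolySeq X R := fun l =>
  ∑ m ∈ Finset.range (l + 1), ∑ n ∈ Finset.range (l + 1), ∑ p ∈ mixableShuffles m n l,
    lam ^ (m + n - l) • (rename (slot p.1) (x m) * rename (slot p.2) (y n))

theorem shuffleMul_smul_smul (lam a b : R) (x y : PolySeq X R) :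
    shuffleMul lam (a • x) (b • y) = (a * b) • shuffleMul lam x y := by
  funext l
  simp only [shuffleMul, Pi.smul_apply, map_smul, Finset.smul_sum, smul_mul_smul_comm]
  exact Finset.sum_congr rfl fun _ _ => Finset.sum_congr rfl fun _ _ =>
    Finset.sum_congr rfl fun _ _ => smul_comm _ _ _

/-- Base change, used both for localization and for reduction modulo a prime. -/
theorem map_shuffleMul {S : Type*} [CommRing S] (φ : R →+* S) (lam : R) (x y : PolySeq X R)
    (l : ℕ) : map φ (shuffleMul lam x y l) =
      shuffleMul (φ lam) (fun n => map φ (x n)) (fun n => map φ (y n)) l := by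
  simp only [shuffleMul, map_sum, smul_eq_C_mul, map_mul, map_rename, map_pow, map_C]

theorem mixableShuffles_add_nonempty (m n : ℕ) : (mixableShuffles m n (m + n)).Nonempty := by
  -- The concatenation: the second word follows the first, except that its letter of index `0`
  -- shares slot `0`.
  refine ⟨(fun i => ⟨i, by omega⟩, fun i => ⟨if i.1 = 0 then 0 else m + i, by split_ifs <;> omega⟩),
    mem_mixableShuffles.2 ⟨⟨fun a b h => h, rfl⟩, ⟨fun a b h => ?_, ?_⟩, fun j => ?_⟩⟩
  · rw [Fin.lt_def] at h ⊢
    dsimp only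
    split_ifs <;> omega
  · ext; simp
  · by_cases h : j.1 ≤ m
    · exact Or.inl ⟨⟨j, by omega⟩, rfl⟩
    · refine Or.inr ⟨⟨j - m, by omega⟩, ?_⟩
      ext
      dsimp only
      split_ifs <;> omega

/-- The product of nonzero sequences of weight zero over a domain of characteristic zero is
nonzero. -/
theorem shuffleMul_zero_ne_zero [IsDomain R] [CharZero R] {x y : PolySeq X R}
    (hx : x ≠ 0) (hy : y ≠ 0) : shuffleMul (0 : R) x y ≠ 0 := by
  classical
  obtain ⟨_, _⟩ := exists_linearOrder_wellFoundedGT X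
  have hwf : ∀ k, WellFoundedGT (Fin k ×ₗ X) := fun k => wellFoundedGT_prodLex _ _
  have hx' : ∃ n, x n ≠ 0 := Function.ne_iff.1 hx
  have hy' : ∃ n, y n ≠ 0 := Function.ne_iff.1 hy
  set m := Nat.find hx' with hm
  set n := Nat.find hy' with hn
  refine Function.ne_iff.2 ⟨m + n, ?_⟩
  have key : shuffleMul (0 : R) x y (m + n) = ∑ p ∈ mixableShuffles m n (m + n),
      rename (slot p.1) (x m) * rename (slot p.2) (y n) := by
    -- Below the minimal degrees a factor vanishes; above them `i + j > m + n`, so at least one pair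
    -- is merged and the power of the weight `0` is zero.
    have h0 : ∀ i j, (i ≠ m ∨ j ≠ n) → ∑ p ∈ mixableShuffles i j (m + n),
        (0 : R) ^ (i + j - (m + n)) • (rename (slot p.1) (x i) * rename (slot p.2) (y j)) = 0 := by
      intro i j hij
      refine Finset.sum_eq_zero fun p hp => ?_
      have := le_of_mem_mixableShuffles hp
      rcases lt_or_ge i m with h | h
      · rw [not_not.1 (Nat.find_min hx' h)]; simp
      · rcases lt_or_ge j n with h' | h'
        · rw [not_not.1 (Nat.find_min hy' h')]; simp
        · rw [zero_pow (by omega), zero_smul]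
    rw [shuffleMul, Finset.sum_eq_single m, Finset.sum_eq_single n]
    · simp
    · intro j _ hj; exact h0 _ _ (Or.inr hj)
    · intro h; exact absurd (Finset.mem_range.2 (by omega)) h
    · intro i _ hi; exact Finset.sum_eq_zero fun j _ => h0 _ _ (Or.inl hi)
    · intro h; exact absurd (Finset.mem_range.2 (by omega)) h
  rw [key]
  exact sum_rename_mul_rename_ne_zero (mixableShuffles_add_nonempty m n)
    (fun p hp => slot_strictMono (mem_mixableShuffles.1 hp).1.1)
    (fun p hp => slot_strictMono (mem_mixableShuffles.1 hp).2.1.1)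
    (Nat.find_spec hx') (Nat.find_spec hy')

/-- One factor `p` is stripped from the whole sequence at a time; the coefficient not divisible by
`p ^ k` forces this to stop. -/
theorem exists_eq_pow_smul {p : R} (k : ℕ) (x : PolySeq X R)
    (h : ∃ n u, ¬ p ^ k ∣ coeff u (x n)) :
    ∃ (j : ℕ) (x' : PolySeq X R), x = p ^ j • x' ∧ ∃ n u, ¬ p ∣ coeff u (x' n) := by
  induction k generalizing x with
  | zero => simp at h
  | succ k ih =>
    by_cases hp : ∃ n u, ¬ p ∣ coeff u (x n)
    · exact ⟨0, x, by simp, hp⟩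
    push Not at hp
    have : ∀ n, ∃ z, x n = p • z := fun n => by
      obtain ⟨z, hz⟩ := (C_dvd_iff_dvd_coeff _ _).2 (hp n)
      exact ⟨z, by rw [hz, smul_eq_C_mul]⟩
    choose x₁ hx₁ using this
    obtain ⟨j, x', hx', hp'⟩ := ih x₁ (by
      obtain ⟨n, u, hu⟩ := h
      refine ⟨n, u, fun hd => hu ?_⟩
      rw [hx₁, coeff_smul, pow_succ', smul_eq_mul]
      exact mul_dvd_mul_left _ hd)
    refine ⟨j + 1, x', ?_, hp'⟩
    funext n
    rw [hx₁, hx', Pi.smul_apply, Pi.smul_apply, smul_smul, pow_succ']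

/-- Over a unique factorization domain containing the rationals, the mixed shuffle product whose
weight is not a unit has no zero divisors. -/
theorem shuffleMul_ne_zero_of_uniqueFactorizationMonoid [IsDomain R]
    [UniqueFactorizationMonoid R] (ψ : ℚ →+* R) {lam : R} (hlam : ¬ IsUnit lam)
    {x y : PolySeq X R} (hx : x ≠ 0) (hy : y ≠ 0) : shuffleMul lam x y ≠ 0 := by
  by_cases h0 : lam = 0
  · have : CharZero R := charZero_of_injective_ringHom ψ.injective
    rw [h0]
    exact shuffleMul_zero_ne_zero hx hy
  obtain ⟨p, hp, hpl⟩ := WfDvdMonoid.exists_irreducible_factor hlam h0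
  have hp : Prime p := UniqueFactorizationMonoid.irreducible_iff_prime.1 hp
  have hex : ∀ {z : PolySeq X R}, z ≠ 0 →
      ∃ (j : ℕ) (z' : PolySeq X R), z = p ^ j • z' ∧ ∃ n u, ¬ p ∣ coeff u (z' n) := by
    intro z hz
    obtain ⟨n, hn⟩ := Function.ne_iff.1 hz
    obtain ⟨u, hu⟩ := ne_zero_iff.1 hn
    -- A single nonzero coefficient bounds the power of `p` dividing the sequence; finite
    -- multiplicity supplies the exponent in the form `k + 1`.
    obtain ⟨k, hk⟩ := FiniteMultiplicity.of_not_isUnit hp.not_isUnit hu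
    exact exists_eq_pow_smul (k + 1) z ⟨n, u, hk⟩
  obtain ⟨i, x', rfl, hx'⟩ := hex hx
  obtain ⟨j, y', rfl, hy'⟩ := hex hy
  rw [shuffleMul_smul_smul]
  refine smul_ne_zero (mul_ne_zero (pow_ne_zero _ hp.ne_zero) (pow_ne_zero _ hp.ne_zero)) ?_
  let φ := Ideal.Quotient.mk (Ideal.span {p})
  have : (Ideal.span {p}).IsPrime := (Ideal.span_singleton_prime hp.ne_zero).2 hp
  -- The field `ℚ` maps to the nontrivial quotient, so reduction modulo `p` keeps characteristic
  -- zero.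
  have : CharZero (R ⧸ Ideal.span {p}) := charZero_of_injective_ringHom (φ.comp ψ).injective
  have hφ : ∀ {z : PolySeq X R}, (∃ n u, ¬ p ∣ coeff u (z n)) →
      (fun n => map φ (z n)) ≠ 0 := by
    rintro z ⟨n, u, hu⟩ h
    have := congrArg (coeff u) (congrFun h n)
    rw [coeff_map, Pi.zero_apply, coeff_zero, Ideal.Quotient.eq_zero_iff_dvd] at this
    exact hu this
  intro h
  refine shuffleMul_zero_ne_zero (hφ hx') (hφ hy') ?_
  funext l
  have := map_shuffleMul φ lam x' y' l
  rw [h, Pi.zero_apply, map_zero,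
    show φ lam = 0 from (Ideal.Quotient.eq_zero_iff_dvd p lam).2 hpl] at this
  exact this.symm

/-- The same over a domain containing the rationals whose localizations at the maximal ideals are
unique factorization domains. -/
theorem shuffleMul_ne_zero [IsDomain R] [Algebra ℚ R]
    (hR : ∀ (M : Ideal R) [M.IsMaximal], UniqueFactorizationMonoid (Localization.AtPrime M))
    {lam : R} (hlam : ¬ IsUnit lam) {x y : PolySeq X R} (hx : x ≠ 0) (hy : y ≠ 0) :
    shuffleMul lam x y ≠ 0 := by
  -- Choosing `M` to contain `lam` keeps `lam` a nonunit after localization.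
  obtain ⟨M, hM, hlM⟩ := exists_max_ideal_of_mem_nonunits hlam
  have := hR M
  let φ := algebraMap R (Localization.AtPrime M)
  have hinj : Function.Injective φ :=
    IsLocalization.injective _ M.primeCompl_le_nonZeroDivisors
  have hφ : ∀ {z : PolySeq X R}, z ≠ 0 → (fun n => map φ (z n)) ≠ 0 := fun hz h =>
    hz (funext fun n => map_injective φ hinj ((congrFun h n).trans (map_zero _).symm))
  have hu : ¬ IsUnit (φ lam) := fun h =>
    (IsLocalization.AtPrime.isUnit_to_map_iff (Localization.AtPrime M) M lam).1 h hlM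
  have : IsDomain (Localization.AtPrime M) :=
    IsLocalization.isDomain_localization M.primeCompl_le_nonZeroDivisors
  intro h
  refine shuffleMul_ne_zero_of_uniqueFactorizationMonoid (φ.comp (algebraMap ℚ R)) hu
    (hφ hx) (hφ hy) ?_
  funext l
  rw [← map_shuffleMul, h, Pi.zero_apply, map_zero, Pi.zero_apply]

end Sequences

/-! ### Tensor powers of a polynomial algebra as polynomial algebras -/

section TensorPower

variable (C : Type*) [CommRing C]

theorem place_singleAlgHom (A : Type*) [CommRing A] [Algebra C A] {m l : ℕ}
    (f : Fin m → Fin l) (i : Fin m) (a : A) :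
    place C A f (PiTensorProduct.singleAlgHom (R := C) (A := fun _ : Fin m => A) i a) =
      PiTensorProduct.singleAlgHom (R := C) (A := fun _ : Fin l => A) (f i) a := by
  rw [PiTensorProduct.singleAlgHom_apply, PiTensorProduct.singleAlgHom_apply, place_tprod]
  congr 1
  funext j
  simp only [MonoidHom.mulSingle_apply, Pi.mulSingle_apply, Finset.prod_ite_eq', Finset.mem_filter,
    Finset.mem_univ, true_and]
  exact if_congr eq_comm rfl rfl

/-- The tensor power `C[X]^{⊗n}` as a polynomial algebra in `n` copies of the variables. -/
noncomputable def toPoly (X : Type*) (n : ℕ) :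
    (⨂[C]^n (MvPolynomial X C)) →ₐ[C] MvPolynomial (Fin n ×ₗ X) C :=
  PiTensorProduct.liftAlgHom
    ((MultilinearMap.mkPiAlgebra C (Fin n) (MvPolynomial (Fin n ×ₗ X) C)).compLinearMap
      (fun i => (MvPolynomial.rename fun x => toLex (i, x)).toLinearMap))
    (by simp [map_one])
    (by intro x y; simp [← Finset.prod_mul_distrib])

theorem toPoly_singleAlgHom (X : Type*) (n : ℕ) (i : Fin n) (a : MvPolynomial X C) :
    toPoly C X n (PiTensorProduct.singleAlgHom (R := C) (A := fun _ : Fin n => MvPolynomial X C)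
      i a) = MvPolynomial.rename (fun x => toLex (i, x)) a := by
  simp only [toPoly, PiTensorProduct.liftAlgHom_apply, PiTensorProduct.singleAlgHom_apply,
    PiTensorProduct.lift.tprod, MultilinearMap.compLinearMap_apply,
    MultilinearMap.mkPiAlgebra_apply, AlgHom.toLinearMap_apply]
  rw [Finset.prod_eq_single i]
  · simp
  · intro j _ hj
    simp [hj]
  · simp

theorem toPoly_injective (X : Type*) (n : ℕ) : Function.Injective (toPoly C X n) := by
  let ψ : MvPolynomial (Fin n ×ₗ X) C →ₐ[C] (⨂[C]^n (MvPolynomial X C)) :=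
    MvPolynomial.aeval fun s => PiTensorProduct.singleAlgHom (R := C)
      (A := fun _ : Fin n => MvPolynomial X C) (ofLex s).1 (MvPolynomial.X (ofLex s).2)
  have h : ψ.comp (toPoly C X n) = AlgHom.id C _ := by
    -- An algebra homomorphism on the tensor power is determined by the variables placed in single
    -- slots.
    refine PiTensorProduct.algHom_ext fun i => MvPolynomial.algHom_ext fun x => ?_
    rw [AlgHom.comp_apply, AlgHom.comp_apply, toPoly_singleAlgHom, MvPolynomial.rename_X,
      MvPolynomial.aeval_X]
    rfl
  exact Function.LeftInverse.injective (g := ψ) fun x => DFunLike.congr_fun h x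

theorem toPoly_place {X : Type*} {m l : ℕ} (f : Fin m → Fin l)
    (x : ⨂[C]^m (MvPolynomial X C)) :
    toPoly C X l (place C _ f x) = MvPolynomial.rename (slot f) (toPoly C X m x) := by
  have h : (toPoly C X l).comp (place C _ f) =
      (MvPolynomial.rename (slot f)).comp (toPoly C X m) := by
    refine PiTensorProduct.algHom_ext fun i => MvPolynomial.algHom_ext fun x => ?_
    rw [AlgHom.comp_apply, AlgHom.comp_apply, AlgHom.comp_apply, AlgHom.comp_apply,
      place_singleAlgHom, toPoly_singleAlgHom, toPoly_singleAlgHom, MvPolynomial.rename_X,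
      MvPolynomial.rename_X, MvPolynomial.rename_X]
    rfl
  exact DFunLike.congr_fun h x

instance [Nontrivial C] (X : Type*) (n : ℕ) : Nontrivial (⨂[C]^n (MvPolynomial X C)) :=
  (toPoly C X n).toRingHom.domain_nontrivial

end TensorPower

/-! ### Components of the complete algebra and the nonunit case -/

namespace CompleteSha

variable {C : Type*} [CommRing C] {lam : C} {A : Type*} [CommRing A] [Algebra C A]

/-- The component in `A^{⊗(n+1)}` of an element of the complete shuffle algebra. -/
noncomputable def comp (n : ℕ) (a : CompleteSha C lam A) : ⨂[C]^(n + 1) A :=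
  Sha.proj C lam A n (Quotient.out (a.1 (n + 1)))

/-- Level `n + 1` is the first quotient that sees degree `n`; compatibility of the family makes the
component independent of the level above it and of the representative. -/
theorem proj_eq_comp {a : CompleteSha C lam A} {k : ℕ} {x : Sha C lam A}
    (h : a.1 k = Ideal.Quotient.mk _ x) {n : ℕ} (hn : n < k) : Sha.proj C lam A n x = comp n a := by
  have h1 := a.2 (n + 1) k hn
  rw [h, Ideal.Quotient.factor_mk, ← Ideal.Quotient.mk_out (a.1 (n + 1)), Ideal.Quotient.eq] at h1
  have h2 := h1 n n.lt_succ_self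
  rwa [map_sub, sub_eq_zero] at h2

theorem comp_mul (l : ℕ) (a b : CompleteSha C lam A) : comp l (a * b) =
    ∑ m ∈ Finset.range (l + 1), ∑ n ∈ Finset.range (l + 1),
      shuffleComponent C lam A m n l (comp m a) (comp n b) := by
  -- Representatives at level `l + 1` suffice, since degree `l` of a product involves only degrees
  -- at most `l` of the factors.
  obtain ⟨x, hx⟩ := Ideal.Quotient.mk_surjective (a.1 (l + 1))
  obtain ⟨y, hy⟩ := Ideal.Quotient.mk_surjective (b.1 (l + 1))
  have h : (a * b).1 (l + 1) = Ideal.Quotient.mk _ (x * y) := by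
    rw [map_mul, hx, hy]; rfl
  rw [← proj_eq_comp h l.lt_succ_self, Sha.proj_mul]
  refine Finset.sum_congr rfl fun m hm => Finset.sum_congr rfl fun n hn => ?_
  rw [proj_eq_comp hx.symm (Finset.mem_range.1 hm), proj_eq_comp hy.symm (Finset.mem_range.1 hn)]

theorem eq_zero_of_comp {a : CompleteSha C lam A} (h : ∀ n, comp n a = 0) : a = 0 := by
  refine Subtype.ext (funext fun k => ?_)
  obtain ⟨x, hx⟩ := Ideal.Quotient.mk_surjective (a.1 k)
  rw [← hx]
  exact Ideal.Quotient.eq_zero_iff_mem.2 fun n hn => (proj_eq_comp hx.symm hn).trans (h n)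

instance {X : Type*} [Nontrivial C] : Nontrivial (CompleteFreeBaxter C lam X) := by
  refine ⟨1, 0, fun h => ?_⟩
  have h1 : (Ideal.Quotient.mk (Sha.fil C lam (MvPolynomial X C) 1)) 1 = 0 :=
    congrFun (congrArg Subtype.val h) 1
  have h2 := Ideal.Quotient.eq_zero_iff_mem.1 h1 0 Nat.one_pos
  rw [Sha.one_def, Sha.proj_of_self] at h2
  exact one_ne_zero h2

/-- The components of an element of the complete free Baxter algebra, as polynomials. -/
noncomputable def polySeq {X : Type*} (a : CompleteFreeBaxter C lam X) : PolySeq X C :=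
  fun n => toPoly C X (n + 1) (comp n a)

theorem polySeq_mul {X : Type*} (a b : CompleteFreeBaxter C lam X) :
    polySeq (a * b) = shuffleMul lam (polySeq a) (polySeq b) := by
  funext l
  simp only [polySeq, shuffleMul, comp_mul, map_sum, shuffleComponent_apply, map_smul, map_mul,
    toPoly_place]

theorem polySeq_ne_zero {X : Type*} {a : CompleteFreeBaxter C lam X} (ha : a ≠ 0) :
    polySeq a ≠ 0 := fun h => ha (eq_zero_of_comp fun n =>
  toPoly_injective C X (n + 1) ((congrFun h n).trans (map_zero _).symm))

theorem isDomain_of_not_isUnit [IsDomain C] [Algebra ℚ C]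
    (hC : ∀ (M : Ideal C) [M.IsMaximal], UniqueFactorizationMonoid (Localization.AtPrime M))
    (X : Type*) (hlam : ¬ IsUnit lam) : IsDomain (CompleteFreeBaxter C lam X) := by
  have : NoZeroDivisors (CompleteFreeBaxter C lam X) := ⟨fun {a b} h => by
    by_contra! hab
    have := shuffleMul_ne_zero hC hlam (polySeq_ne_zero hab.1) (polySeq_ne_zero hab.2)
    rw [← polySeq_mul, h] at this
    refine this (funext fun n => ?_)
    rw [polySeq, ← proj_eq_comp (x := 0) (k := n + 1) (map_zero _).symm n.lt_succ_self, map_zero,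
      map_zero]
    rfl⟩
  exact NoZeroDivisors.to_isDomain _

/-! ### Zero divisors for a unit weight -/

section Unit

/-- Since `uₙ₊₁ = P(uₙ)`, the Baxter identity gives `u₁ uₙ₊₁ = P(u₀) P(uₙ) = uₙ₊₂ + P(u₁ uₙ) + lam
uₙ₊₁`, and induction applies to the middle term. -/
theorem of_one_mul_of_one (n : ℕ) : Sha.of C lam A 1 1 * Sha.of C lam A n 1 =
    (n + 1 : C) • Sha.of C lam A (n + 1) 1 + (lam * n) • Sha.of C lam A n 1 := by
  have hP : ∀ k, Sha.baxterOp C lam A (Sha.of C lam A k 1) = Sha.of C lam A (k + 1) 1 :=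
    fun k => by rw [Sha.baxterOp_of, map_one]
  have h0 : (Sha.of C lam A 0 1) = 1 := rfl
  induction n with
  | zero => simp [h0]
  | succ n ih =>
    have h := Sha.baxterOp_mul_baxterOp lam (Sha.of C lam A 0 1) (Sha.of C lam A n 1)
    rw [hP, hP, h0, one_mul, one_mul, hP, mul_comm (Sha.of C lam A n 1), zero_add, ih, map_add,
      map_smul, map_smul, hP, hP] at h
    rw [h]
    push_cast
    module

theorem of_one_mul_sum {c : C} (hc : lam * c = -1) (k : ℕ) :
    Sha.of C lam A 1 1 * ∑ n ∈ Finset.range (k + 1), c ^ n • Sha.of C lam A n 1 =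
      (c ^ k * (k + 1)) • Sha.of C lam A (k + 1) 1 := by
  induction k with
  | zero => simp [of_one_mul_of_one]
  | succ k ih =>
    -- The lower term of the new product cancels the remainder of the previous partial sum.
    have h : c ^ (k + 1) * (lam * (k + 1 : C)) = -(c ^ k * (k + 1)) := by
      linear_combination c ^ k * (k + 1) * hc
    rw [Finset.sum_range_succ, mul_add, ih, mul_smul_comm, of_one_mul_of_one, smul_add, smul_smul,
      smul_smul]
    push_cast
    rw [h]
    module

theorem of_mem_fil {n k : ℕ} (h : k ≤ n) (x : ⨂[C]^(n + 1) A) :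
    Sha.of C lam A n x ∈ Sha.fil C lam A k :=
  fun _ hj => Sha.proj_of_ne lam (hj.trans_le h).ne' x

variable (lam A) in
/-- The geometric series `∑ₙ cⁿ (1 ⊗ ⋯ ⊗ 1)`. -/
noncomputable def geomSeries (c : C) : CompleteSha C lam A :=
  ⟨fun k => Ideal.Quotient.mk _ (∑ n ∈ Finset.range k, c ^ n • Sha.of C lam A n 1), by
    intro k l h
    rw [Ideal.Quotient.factor_mk, Ideal.Quotient.eq, ← Finset.sum_range_add_sum_Ico _ h,
      add_sub_cancel_left]
    refine Ideal.sum_mem _ fun n hn => ?_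
    rw [← map_smul]
    exact of_mem_fil (Finset.mem_Ico.1 hn).1 _⟩

theorem not_isDomain_of_isUnit [Nontrivial C] (X : Type*) (hlam : IsUnit lam) :
    ¬ IsDomain (CompleteFreeBaxter C lam X) := by
  intro hd
  obtain ⟨d, hd⟩ := hlam.exists_right_inv
  have hc : lam * -d = -1 := by rw [mul_neg, hd]
  let e : CompleteFreeBaxter C lam X :=
    ⟨fun k => Ideal.Quotient.mk _ (Sha.of C lam (MvPolynomial X C) 1 1), fun k l h => by
      rw [Ideal.Quotient.factor_mk]⟩
  have h : e * geomSeries lam (MvPolynomial X C) (-d) = 0 := by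
    refine Subtype.ext (funext fun k => ?_)
    change Ideal.Quotient.mk (Sha.fil C lam (MvPolynomial X C) k) (Sha.of C lam _ 1 1 *
      ∑ n ∈ Finset.range k, (-d) ^ n • Sha.of C lam _ n 1) = 0
    rw [Ideal.Quotient.eq_zero_iff_mem]
    cases k with
    | zero => exact fun n hn => absurd hn n.not_lt_zero
    | succ k =>
      -- Only a multiple of `uₖ₊₁` remains, which lies in the `(k + 1)`-st filtration ideal.
      rw [of_one_mul_sum hc, ← map_smul]
      exact of_mem_fil le_rfl _
  -- Neither factor vanishes: `e` has component `1` in degree `1`, and the series has component `1`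
  -- in degree `0`.
  rcases mul_eq_zero.1 h with h | h
  · have h1 : Ideal.Quotient.mk (Sha.fil C lam (MvPolynomial X C) 2) (Sha.of C lam _ 1 1) = 0 :=
      congrFun (congrArg Subtype.val h) 2
    have h2 := Ideal.Quotient.eq_zero_iff_mem.1 h1 1 Nat.one_lt_two
    rw [Sha.proj_of_self] at h2
    exact one_ne_zero h2
  · have h1 : Ideal.Quotient.mk (Sha.fil C lam (MvPolynomial X C) 1)
        (∑ n ∈ Finset.range 1, (-d) ^ n • Sha.of C lam _ n 1) = 0 :=
      congrFun (congrArg Subtype.val h) 1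
    have h2 := Ideal.Quotient.eq_zero_iff_mem.1 h1 0 Nat.one_pos
    rw [Finset.sum_range_one, pow_zero, one_smul, Sha.proj_of_self] at h2
    exact one_ne_zero h2

end Unit

end CompleteSha

end Baxter

theorem mainTheorem2 {C : Type*} [CommRing C] [IsDomain C] [Algebra ℚ C]
    (hC : ∀ (M : Ideal C) [M.IsMaximal], UniqueFactorizationMonoid (Localization.AtPrime M))
    (X : Type*) (lam : C) :
    IsDomain (Baxter.CompleteFreeBaxter C lam X) ↔ ¬ IsUnit lam :=
  ⟨fun hd hlam => Baxter.CompleteSha.not_isDomain_of_isUnit X hlam hd,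
    Baxter.CompleteSha.isDomain_of_not_isUnit hC X⟩
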